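/- Let $X$ be a random variable with values in $\mathbb Z$, and let $p_j=\mathbf P[X=j]$, $j\in\mathbb Z$. Suppose that $p_j>0$ for all $j\in\mathbb Z$, that $X$ is symmetric ($X$ and $-X$ have the same distribution), and that all moments $m_k=\mathbf E[X^k]$, $k=1,2,\ldots$, are finite. Suppose further that for some integer $j_0\ge 2$ $$\sum_{|j|\ge j_0}\frac{-\ln p_j}{j^2\,\ln|j|}=\infty ,$$ and that the sequence $\dfrac{-\ln p_j}{\ln j}$, $j=j_0,j_0+1,\ldots$, is monotone increasing (not necessarily strictly) and tends to $\infty$ as $j\to\infty$. Then $X$ satisfies Carleman's condition $\sum_{k=1}^\infty (m_{2k})^{-1/(2k)}=\infty$, and $X$ is moment-determinate: the distribution of $X$ is the only probability distribution on $\mathbb R$ all of whose moments are finite and equal to those of $X$. Moreover, $X^2$ is moment-determinate on $\mathbb R_+=[0,\infty)$: the distribution of $X^2$ is the only probability distribution on $[0,\infty)$ all of whose moments are finite and equal to those of $X^2$. -/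

import Mathlib

open MeasureTheory ProbabilityTheory Set Filter

noncomputable section

/-- All moments of the measure `μ` on the real line are finite: `∫ |x|^k dμ < ∞` for all `k`. -/
def HasFiniteMoments (μ : Measure ℝ) : Prop :=
  ∀ k : ℕ, Integrable (fun x : ℝ => x ^ k) μ

/-- The `k`-th moment `m_k = ∫ x^k dμ`. -/
def momentSeq (μ : Measure ℝ) (k : ℕ) : ℝ := ∫ x, x ^ k ∂μ

/-- Carleman's condition (Hamburger case): all moments are finite and
`∑_{k ≥ 1} (m_{2k})^{-1/(2k)} = ∞`. The sum is taken in `[0, ∞]`; its index is shifted by one. -/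
def CarlemanHamburger (μ : Measure ℝ) : Prop :=
  HasFiniteMoments μ ∧
    ∑' k : ℕ, ENNReal.ofReal (momentSeq μ (2 * (k + 1))) ^ (-(1 / (2 * ((k : ℝ) + 1)))) = ⊤

/-- `μ` is moment-determinate on the real line: its moments are finite, and it is the only
Borel probability measure on `ℝ` with these moments. -/
def MomentDeterminate (μ : Measure ℝ) : Prop :=
  HasFiniteMoments μ ∧
    ∀ ν : Measure ℝ, IsProbabilityMeasure ν → HasFiniteMoments ν →
      (∀ k : ℕ, momentSeq ν k = momentSeq μ k) → ν = μ

/-- `μ` is moment-determinate on the half-line `[0, ∞)`: it is carried by `[0, ∞)`, its moments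
are finite, and it is the only Borel probability measure carried by `[0, ∞)` with these moments. -/
def MomentDeterminateOnNonneg (μ : Measure ℝ) : Prop :=
  μ (Iio 0) = 0 ∧ HasFiniteMoments μ ∧
    ∀ ν : Measure ℝ, IsProbabilityMeasure ν → ν (Iio 0) = 0 → HasFiniteMoments ν →
      (∀ k : ℕ, momentSeq ν k = momentSeq μ k) → ν = μ

end

/-! Write p_j = j^(-h(j)) for large j. If h(j) ≥ 2k+4, monotonicity gives i^(2k+2) p_i ≤ 1/i² for
all |i| ≥ j, so m_{2k+2} is at most j^(2k+2) plus a constant and the corresponding Carleman term is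
at least c/j. Let J_k be the first admissible j. Since h(j) is at most twice the number of
thresholds 2k+4 below it, plus 4, exchanging sums bounds ∑ h(j)/j² by a multiple of ∑ 1/J_k plus a
constant. Hence Carleman's series diverges (`tsum_eq_top_of_tsum_div_sq`).

Determinacy is quasi-analyticity. The difference of two characteristic functions with the same
moments has all derivatives zero at 0 and bounded by 2 M_k, where M_k = √m_{2k} is log-convex.
Carleman's inequality (`summable_geomMean`) turns the divergent series into ∑ M_n/M_{n+1} = ∞, and
`denjoyCarleman`, proved by Bang's method, makes the difference vanish. For X², a competing law is
pulled back to the symmetric law of its ± square root. -/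

open scoped ENNReal

/-! ### Quasi-analyticity: the Denjoy–Carleman theorem. -/

/-- Ratio form of log-convexity: `M (k + 1) / M k` is monotone in `k`. -/
lemma ratio_le_of_logConvex {M : ℕ → ℝ} (hM : ∀ k, 0 < M k)
    (hconv : ∀ k, M (k + 1) ^ 2 ≤ M k * M (k + 2)) {k n : ℕ} (hkn : k ≤ n) :
    M (k + 1) / M k ≤ M (n + 1) / M n := by
  refine monotone_nat_of_le_succ (f := fun k => M (k + 1) / M k) (fun k => ?_) hkn
  rw [div_le_div_iff₀ (hM _) (hM _)]
  nlinarith [hconv k]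

/-- Bang's propagation estimate: smallness of a jet of order `n + 1` at `a` propagates, with the
loss of one order, over a distance `M n / (e * M (n + 1))`. -/
lemma bang_step {g : ℕ → ℝ → ℂ} (hg : ∀ k x, HasDerivAt (g k) (g (k + 1) x) x)
    {M : ℕ → ℝ} (hM : ∀ k, 0 < M k) (hconv : ∀ k, M (k + 1) ^ 2 ≤ M k * M (k + 2))
    {C : ℝ} (hC : 0 ≤ C) (hbound : ∀ k x, ‖g k x‖ ≤ C * M k) (n : ℕ) {a b : ℝ}
    (ha : ∀ k, ‖g k a‖ ≤ C * M k * Real.exp (k - (n + 1)))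
    (hab : a ≤ b) (hb : b - a ≤ Real.exp (-1) * (M n / M (n + 1))) (k : ℕ) :
    ‖g k b‖ ≤ C * M k * Real.exp (k - n) := by
  rcases le_or_gt (n : ℕ) k with h | h
  · refine (hbound k b).trans (le_mul_of_one_le_right (mul_nonneg hC (hM k).le) ?_)
    refine Real.one_le_exp ?_
    rw [sub_nonneg]
    exact_mod_cast h
  set r := M (n + 1) / M n with hr
  have hrpos : 0 < r := div_pos (hM _) (hM _)
  set s := Real.exp 1 * r with hs
  have hspos : 0 < s := mul_pos (Real.exp_pos _) hrpos
  -- Descending in `k`: the bound for order `k + 1` must not exceed the derivative of the bound for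
  -- order `k`. One order costs a factor e and a ratio of at most `r`, hence the rate `s = e * r`.
  have key : ∀ k, k ≤ n + 1 → ∀ x ∈ Icc a b,
      ‖g k x‖ ≤ C * M k * Real.exp (k - (n + 1)) * Real.exp (s * (x - a)) := by
    intro k hk
    induction hk using Nat.decreasingInduction with
    | self =>
      intro x hx
      refine (hbound _ x).trans ?_
      rw [mul_assoc]
      refine le_mul_of_one_le_right (mul_nonneg hC (hM _).le) ?_
      rw [← Real.exp_add]
      refine Real.one_le_exp ?_
      push_cast
      have := mul_nonneg hspos.le (sub_nonneg.2 hx.1)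
      linarith
    | of_succ k hk ih =>
      have hd : ∀ x, HasDerivAt
          (fun x => C * M k * Real.exp (k - (n + 1)) * Real.exp (s * (x - a)))
          (C * M k * Real.exp (k - (n + 1)) * (Real.exp (s * (x - a)) * s)) x := by
        intro x
        have h1 : HasDerivAt (fun x => s * (x - a)) s x := by
          simpa using ((hasDerivAt_id x).sub_const a).const_mul s
        exact h1.exp.const_mul _
      refine image_norm_le_of_norm_deriv_right_le_deriv_boundary (f' := g (k + 1))
        (fun x _ => (hg k x).continuousAt.continuousWithinAt)
        (fun x _ => (hg k x).hasDerivWithinAt) (by simpa using ha k) hd ?_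
      intro x hx
      refine (ih x ⟨hx.1, hx.2.le⟩).trans ?_
      have hMk : M (k + 1) ≤ r * M k :=
        (div_le_iff₀ (hM k)).1 (ratio_le_of_logConvex hM hconv (Nat.lt_succ_iff.1 hk))
      have he : Real.exp (((k + 1 : ℕ) : ℝ) - (n + 1)) = Real.exp (k - (n + 1)) * Real.exp 1 := by
        rw [← Real.exp_add]; congr 1; push_cast; ring
      rw [he]
      calc C * M (k + 1) * (Real.exp (k - (n + 1)) * Real.exp 1) * Real.exp (s * (x - a))
          ≤ C * (r * M k) * (Real.exp (k - (n + 1)) * Real.exp 1) * Real.exp (s * (x - a)) := by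
            gcongr
        _ = _ := by rw [hs]; ring
  refine (key k (by omega) b ⟨hab, le_rfl⟩).trans ?_
  rw [mul_assoc, ← Real.exp_add]
  have hsb : s * (b - a) ≤ 1 := by
    calc s * (b - a) ≤ s * (Real.exp (-1) * (M n / M (n + 1))) := by gcongr
      _ = (Real.exp 1 * Real.exp (-1)) * (M (n + 1) / M n * (M n / M (n + 1))) := by
        rw [hs, hr]; ring
      _ = 1 := by
        rw [← Real.exp_add, div_mul_div_cancel₀ (hM n).ne', div_self (hM _).ne']; simp
  refine mul_le_mul_of_nonneg_left ?_ (mul_nonneg hC (hM k).le)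
  exact Real.exp_le_exp.2 (by linarith)

/-- Denjoy–Carleman on a half-line: a smooth function whose derivatives are dominated by a
log-convex sequence `M` with `∑ M n / M (n + 1) = ∞`, and all vanish at `0`, is zero. -/
lemma denjoyCarleman_of_nonneg {g : ℕ → ℝ → ℂ} (hg : ∀ k x, HasDerivAt (g k) (g (k + 1) x) x)
    {M : ℕ → ℝ} (hM : ∀ k, 0 < M k) (hconv : ∀ k, M (k + 1) ^ 2 ≤ M k * M (k + 2))
    (hdiv : ¬ Summable fun n => M n / M (n + 1))
    {C : ℝ} (hC : 0 ≤ C) (hbound : ∀ k x, ‖g k x‖ ≤ C * M k) (h0 : ∀ k, g k 0 = 0)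
    {x : ℝ} (hx : 0 ≤ x) : g 0 x = 0 := by
  -- Chain `L` Bang steps from 0, where the jet vanishes and so is small to any order. Order `N + L`
  -- at 0 decays to order `N` at `y`.
  have claim : ∀ L N : ℕ, ∀ y, 0 ≤ y →
      y ≤ Real.exp (-1) * ∑ n ∈ Finset.range L, M (N + n) / M (N + n + 1) →
      ∀ k, ‖g k y‖ ≤ C * M k * Real.exp (k - N) := by
    intro L
    induction L with
    | zero =>
      intro N y hy hyL k
      obtain rfl : y = 0 := le_antisymm (by simpa using hyL) hy
      rw [h0, norm_zero]
      exact mul_nonneg (mul_nonneg hC (hM k).le) (Real.exp_pos _).le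
    | succ L ih =>
      intro N y hy hyL
      set d := Real.exp (-1) * (M N / M (N + 1)) with hd
      have hdpos : 0 ≤ d := mul_nonneg (Real.exp_pos _).le (div_pos (hM _) (hM _)).le
      rw [Finset.sum_range_succ', mul_add] at hyL
      have ha := ih (N + 1) (max 0 (y - d)) (le_max_left _ _) (by
        refine max_le (mul_nonneg (Real.exp_pos _).le
          (Finset.sum_nonneg fun _ _ => (div_pos (hM _) (hM _)).le)) ?_
        rw [sub_le_iff_le_add]
        refine hyL.trans_eq ?_
        simp only [hd, add_zero]
        congr 2
        refine Finset.sum_congr rfl fun n _ => ?_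
        rw [show N + (n + 1) = N + 1 + n by ring])
      refine bang_step hg hM hconv hC hbound N (a := max 0 (y - d))
        (fun k => by simpa using ha k) (max_le hy (by linarith)) ?_
      linarith [le_max_right 0 (y - d)]
  have hsmall : ∀ N : ℕ, ‖g 0 x‖ ≤ C * M 0 * Real.exp (-N) := by
    intro N
    have hdivN : ¬ Summable fun n => M (N + n) / M (N + n + 1) := by
      intro h
      refine hdiv ((summable_nat_add_iff N).1 ?_)
      simpa [add_comm, add_left_comm, add_assoc] using h
    have ht := (not_summable_iff_tendsto_nat_atTop_of_nonneg
      (fun n => (div_pos (hM (N + n)) (hM (N + n + 1))).le)).1 hdivN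
    obtain ⟨L, hL⟩ := (ht.eventually_ge_atTop (Real.exp 1 * x)).exists
    have := claim L N x hx (by
      calc x = Real.exp (-1) * (Real.exp 1 * x) := by
            rw [← mul_assoc, ← Real.exp_add]; simp
        _ ≤ _ := by gcongr) 0
    simpa using this
  have hlim : Tendsto (fun N : ℕ => C * M 0 * Real.exp (-N)) atTop (nhds 0) := by
    simpa using ((Real.tendsto_exp_neg_atTop_nhds_zero.comp
      tendsto_natCast_atTop_atTop).const_mul (C * M 0))
  exact norm_le_zero_iff.1 (ge_of_tendsto' hlim hsmall)

lemma denjoyCarleman {g : ℕ → ℝ → ℂ} (hg : ∀ k x, HasDerivAt (g k) (g (k + 1) x) x)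
    {M : ℕ → ℝ} (hM : ∀ k, 0 < M k) (hconv : ∀ k, M (k + 1) ^ 2 ≤ M k * M (k + 2))
    (hdiv : ¬ Summable fun n => M n / M (n + 1))
    {C : ℝ} (hC : 0 ≤ C) (hbound : ∀ k x, ‖g k x‖ ≤ C * M k) (h0 : ∀ k, g k 0 = 0)
    (x : ℝ) : g 0 x = 0 := by
  rcases le_total 0 x with hx | hx
  · exact denjoyCarleman_of_nonneg hg hM hconv hdiv hC hbound h0 hx
  · have := denjoyCarleman_of_nonneg (g := fun k y => (-1) ^ k * g k (-y)) (fun k y => by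
        have h1 := ((hg k (-y)).scomp y (hasDerivAt_neg y)).const_mul ((-1 : ℂ) ^ k)
        refine h1.congr_deriv ?_
        rw [pow_succ]; simp) hM hconv hdiv hC
      (fun k y => by simpa using hbound k (-y)) (fun k => by simp [h0]) (neg_nonneg.2 hx)
    simpa using this

/-! ### Carleman's inequality. -/

/-- **Carleman's inequality**, up to the value of the constant. -/
lemma summable_geomMean {a : ℕ → ℝ} (ha : ∀ n, 0 < a n) (hsum : Summable a) :
    Summable fun n : ℕ => (∏ i ∈ Finset.range (n + 1), a i) ^ (1 / ((n : ℝ) + 1)) := by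
  have hterm : ∀ n : ℕ, (∏ i ∈ Finset.range (n + 1), a i) ^ (1 / ((n : ℝ) + 1)) ≤
      Real.exp 1 * ∑ i ∈ Finset.range (n + 1), (i + 1) * a i / ((n : ℝ) + 1) ^ 2 := by
    intro n
    have hn : (0 : ℝ) < n + 1 := by positivity
    have hP : 0 ≤ ∏ i ∈ Finset.range (n + 1), a i := Finset.prod_nonneg fun i _ => (ha i).le
    -- The weights i + 1 are divided out again through (n+1)!^(1/(n+1)) ≥ (n+1)/e; they make the
    -- double sum below converge.
    have hamgm := Real.geom_mean_le_arith_mean (Finset.range (n + 1)) (fun _ => (1 : ℝ))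
      (fun i => ((i : ℝ) + 1) * a i) (fun _ _ => zero_le_one) (by simpa using hn)
      (fun i _ => mul_nonneg (by positivity) (ha i).le)
    simp only [Real.rpow_one, Finset.prod_mul_distrib, Finset.sum_const, Finset.card_range,
      nsmul_eq_mul, mul_one, one_mul, Nat.cast_add, Nat.cast_one] at hamgm
    have hfac : (∏ i ∈ Finset.range (n + 1), ((i : ℝ) + 1)) = ((n + 1).factorial : ℝ) := by
      rw [← Finset.prod_range_add_one_eq_factorial]; push_cast; rfl
    rw [hfac, Real.mul_rpow (by positivity) hP] at hamgm
    have hfl : ((n : ℝ) + 1) * Real.exp (-1) ≤ ((n + 1).factorial : ℝ) ^ ((n : ℝ) + 1)⁻¹ := by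
      rw [Real.le_rpow_inv_iff_of_pos (by positivity) (by positivity) hn]
      have h := Real.pow_div_factorial_le_exp (x := (n : ℝ) + 1) hn.le (n + 1)
      rw [div_le_iff₀ (by positivity)] at h
      have e1 : (((n : ℝ) + 1) * Real.exp (-1)) ^ ((n : ℝ) + 1) =
          ((n : ℝ) + 1) ^ (n + 1) * Real.exp (-((n : ℝ) + 1)) := by
        rw [Real.mul_rpow hn.le (Real.exp_pos _).le, ← Real.exp_mul]
        congr 1
        · exact_mod_cast Real.rpow_natCast ((n : ℝ) + 1) (n + 1)
        · ring_nf
      rw [e1]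
      calc _ ≤ Real.exp ((n : ℝ) + 1) * ((n + 1).factorial : ℝ) * Real.exp (-((n : ℝ) + 1)) := by
            gcongr
        _ = (Real.exp ((n : ℝ) + 1) * Real.exp (-((n : ℝ) + 1))) * ((n + 1).factorial : ℝ) := by
            ring
        _ = _ := by rw [← Real.exp_add]; simp
    rw [one_div]
    have h2 := (mul_le_mul_of_nonneg_right hfl (Real.rpow_nonneg hP _)).trans hamgm
    rw [← Finset.sum_div]
    rw [le_div_iff₀ hn] at h2
    rw [← mul_div_assoc, le_div_iff₀ (by positivity)]
    calc _ = Real.exp 1 * (((n : ℝ) + 1) * Real.exp (-1) *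
          (∏ i ∈ Finset.range (n + 1), a i) ^ ((n : ℝ) + 1)⁻¹ * ((n : ℝ) + 1)) := by
          have : Real.exp 1 * Real.exp (-1) = 1 := by rw [← Real.exp_add]; simp
          linear_combination (-(∏ i ∈ Finset.range (n + 1), a i) ^ ((n : ℝ) + 1)⁻¹ *
            ((n : ℝ) + 1) ^ 2) * this
      _ ≤ _ := by gcongr
  -- The term `- 1 / N` makes the induction on `N` telescope.
  have htail : ∀ N i : ℕ, i < N →
      ∑ n ∈ Finset.Ico i N, 1 / ((n : ℝ) + 1) ^ 2 ≤ 2 / ((i : ℝ) + 1) - 1 / N := by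
    intro N i hi
    induction N, hi using Nat.le_induction with
    | base =>
      simp only [Nat.succ_eq_add_one, Nat.Ico_succ_singleton, Finset.sum_singleton]
      push_cast
      rw [← sub_div, div_le_div_iff₀ (by positivity) (by positivity)]
      have : (0 : ℝ) ≤ i := Nat.cast_nonneg i
      nlinarith
    | succ N hN ih =>
      rw [Finset.sum_Ico_succ_top (by omega)]
      have hNpos : (0 : ℝ) < N := by exact_mod_cast (by omega : 0 < N)
      have : 1 / ((N : ℝ) + 1) ^ 2 ≤ 1 / N - 1 / ((N + 1 : ℕ) : ℝ) := by
        push_cast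
        rw [div_sub_div _ _ hNpos.ne' (by positivity), div_le_div_iff₀ (by positivity)
          (by positivity)]
        nlinarith
      linarith
  have hpart : ∀ N : ℕ, ∑ n ∈ Finset.range N,
      ∑ i ∈ Finset.range (n + 1), (i + 1) * a i / ((n : ℝ) + 1) ^ 2 ≤
      2 * ∑ i ∈ Finset.range N, a i := by
    intro N
    rw [Finset.sum_sigma', Finset.mul_sum]
    have : ∀ i ∈ Finset.range N, ∑ n ∈ Finset.Ico i N, (i + 1) * a i / ((n : ℝ) + 1) ^ 2
        ≤ 2 * a i := by
      intro i hi
      have h := htail N i (Finset.mem_range.1 hi)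
      have h3 : (0 : ℝ) ≤ 1 / N := by positivity
      have hi0 : (0 : ℝ) < i + 1 := by positivity
      calc _ = ((i + 1) * a i) * ∑ n ∈ Finset.Ico i N, 1 / ((n : ℝ) + 1) ^ 2 := by
            rw [Finset.mul_sum]
            exact Finset.sum_congr rfl fun n _ => by ring
        _ ≤ ((i + 1) * a i) * (2 / ((i : ℝ) + 1)) := by
            refine mul_le_mul_of_nonneg_left (by linarith) (mul_nonneg hi0.le (ha i).le)
        _ = _ := by field_simp
    refine le_trans (le_of_eq ?_) (Finset.sum_le_sum this)
    rw [Finset.sum_sigma']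
    refine Finset.sum_bij' (fun x _ => ⟨x.2, x.1⟩) (fun x _ => ⟨x.2, x.1⟩) ?_ ?_ ?_ ?_ ?_ <;>
      simp <;> omega
  refine summable_of_sum_range_le (c := Real.exp 1 * (2 * ∑' i, a i))
    (fun n => Real.rpow_nonneg (Finset.prod_nonneg fun i _ => (ha i).le) _) fun N => ?_
  refine (Finset.sum_le_sum fun n _ => hterm n).trans ?_
  rw [← Finset.mul_sum]
  gcongr
  exact (hpart N).trans (by gcongr; exact hsum.sum_le_tsum _ fun i _ => (ha i).le)

/-! ### Moments, characteristic functions and Carleman's theorem. -/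

/-- The Cauchy–Schwarz inequality for real integrals. -/
lemma sq_integral_mul_le {α : Type*} [MeasurableSpace α] {μ : Measure α} {f g : α → ℝ}
    (hf : Integrable (fun x => f x ^ 2) μ) (hg : Integrable (fun x => g x ^ 2) μ)
    (hfg : Integrable (fun x => f x * g x) μ) :
    (∫ x, f x * g x ∂μ) ^ 2 ≤ (∫ x, f x ^ 2 ∂μ) * ∫ x, g x ^ 2 ∂μ := by
  have h := discrim_le_zero (a := ∫ x, f x ^ 2 ∂μ) (b := 2 * ∫ x, f x * g x ∂μ)
    (c := ∫ x, g x ^ 2 ∂μ) fun t => by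
      have hpos : 0 ≤ ∫ x, (t * f x + g x) ^ 2 ∂μ := integral_nonneg fun x => sq_nonneg _
      have heq : ∫ x, (t * f x + g x) ^ 2 ∂μ =
          ∫ x, (t ^ 2 * f x ^ 2 + 2 * t * (f x * g x)) + g x ^ 2 ∂μ := by
        congr 1; ext x; ring
      have hint : Integrable (fun x => t ^ 2 * f x ^ 2 + 2 * t * (f x * g x)) μ :=
        (hf.const_mul _).add (hfg.const_mul _)
      rw [heq, integral_add hint hg,
        integral_add (hf.const_mul _) (hfg.const_mul _), integral_const_mul,
        integral_const_mul] at hpos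
      linarith
  rw [discrim] at h
  nlinarith

lemma HasFiniteMoments.memLp_id {μ : Measure ℝ} (h : HasFiniteMoments μ) (k : ℕ) :
    MemLp id k μ := by
  rcases Nat.eq_zero_or_pos k with rfl | hk
  · simpa using (measurable_id.aestronglyMeasurable : AEStronglyMeasurable id μ)
  · refine (integrable_norm_rpow_iff measurable_id.aestronglyMeasurable
      (by exact_mod_cast hk.ne') (ENNReal.natCast_ne_top k)).1 ?_
    simpa using (h k).norm

lemma momentSeq_sq_le {μ : Measure ℝ} (h : HasFiniteMoments μ) (k : ℕ) :
    momentSeq μ (2 * (k + 1)) ^ 2 ≤ momentSeq μ (2 * k) * momentSeq μ (2 * (k + 2)) := by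
  have := sq_integral_mul_le (μ := μ) (f := fun x => x ^ k) (g := fun x => x ^ (k + 2))
    (by simpa only [← pow_mul] using h _) (by simpa only [← pow_mul] using h _)
    (by simpa only [← pow_add] using h _)
  simp only [momentSeq]
  convert this using 3 <;> (ext x; ring)

/-- The derivative is at most the absolute moment of order `k`; Cauchy–Schwarz against 1 replaces it
by an even moment, which laws with equal moments share. -/
lemma norm_iteratedDeriv_charFun_le {μ : Measure ℝ} [IsProbabilityMeasure μ]
    (h : HasFiniteMoments μ) (k : ℕ) (t : ℝ) :
    ‖iteratedDeriv k (charFun μ) t‖ ≤ √(momentSeq μ (2 * k)) := by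
  rw [iteratedDeriv_charFun (h.memLp_id k), norm_mul, norm_pow, Complex.norm_I, one_pow, one_mul]
  have habs : Integrable (fun x : ℝ => |x ^ k|) μ := (h k).abs
  have hle : ‖∫ x : ℝ, (x : ℂ) ^ k * Complex.exp (t * x * Complex.I) ∂μ‖ ≤ ∫ x, |x ^ k| ∂μ := by
    refine (norm_integral_le_integral_norm _).trans (le_of_eq ?_)
    congr 1; ext x
    rw [norm_mul, ← Complex.ofReal_mul, Complex.norm_exp_ofReal_mul_I, mul_one, norm_pow,
      Complex.norm_real, Real.norm_eq_abs, abs_pow]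
  refine hle.trans (Real.le_sqrt_of_sq_le ?_)
  have := sq_integral_mul_le (μ := μ) (f := fun x => |x ^ k|) (g := fun _ => 1)
    (by simpa only [sq_abs, ← pow_mul] using h _) (by simp) (by simpa using habs)
  simp only [mul_one, one_pow, sq_abs, ← pow_mul, integral_const, probReal_univ, smul_eq_mul]
    at this
  rwa [mul_comm k 2] at this

/-- **Carleman's theorem** on the line: Carleman's condition implies determinacy. -/
theorem CarlemanHamburger.momentDeterminate {μ : Measure ℝ} [IsProbabilityMeasure μ]
    (hC : CarlemanHamburger μ) (hpos : ∀ k, 0 < momentSeq μ (2 * k)) : MomentDeterminate μ := by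
  obtain ⟨hμ, hdiv⟩ := hC
  refine ⟨hμ, fun ν hν hνm heq => ?_⟩
  set M : ℕ → ℝ := fun k => √(momentSeq μ (2 * k)) with hMdef
  have hM : ∀ k, 0 < M k := fun k => Real.sqrt_pos.2 (hpos k)
  have hM0 : M 0 = 1 := by simp [hMdef, momentSeq]
  have hconv : ∀ k, M (k + 1) ^ 2 ≤ M k * M (k + 2) := fun k => by
    rw [← Real.sqrt_mul (hpos k).le, Real.sq_sqrt (hpos _).le]
    exact Real.le_sqrt_of_sq_le (momentSeq_sq_le hμ k)
  have hnot : ¬ Summable fun n => M n / M (n + 1) := by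
    intro hs
    have hs' := summable_geomMean (fun n => div_pos (hM n) (hM (n + 1))) hs
    -- The ratios telescope, so their geometric means are exactly the terms of Carleman's series.
    have hprod : ∀ n, ∏ i ∈ Finset.range n, M i / M (i + 1) = (M n)⁻¹ := by
      intro n
      induction n with
      | zero => simp [hM0]
      | succ n ih => rw [Finset.prod_range_succ, ih]; have := (hM n).ne'; field_simp
    have hne := hs'.tsum_ofReal_ne_top
    refine hne ?_
    rw [← hdiv]
    congr 1; ext n
    rw [hprod, ENNReal.ofReal_rpow_of_pos (hpos _)]
    congr 1
    have hn : (0 : ℝ) < n + 1 := by positivity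
    rw [hMdef]
    simp only [Real.sqrt_eq_rpow]
    rw [← Real.rpow_neg (hpos _).le, ← Real.rpow_mul (hpos _).le]
    congr 1
    field_simp
  refine Measure.ext_of_charFun (funext fun t => ?_)
  have hcd : ∀ (ρ : Measure ℝ) [IsProbabilityMeasure ρ], HasFiniteMoments ρ → ∀ k x,
      HasDerivAt (iteratedDeriv k (charFun ρ)) (iteratedDeriv (k + 1) (charFun ρ) x) x := by
    intro ρ _ hρ k x
    rw [iteratedDeriv_succ]
    exact ((contDiff_charFun (n := k + 1) (hρ.memLp_id (k + 1))).differentiable_iteratedDeriv' k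
      x).hasDerivAt
  have := denjoyCarleman
    (g := fun k x => iteratedDeriv k (charFun ν) x - iteratedDeriv k (charFun μ) x)
    (fun k x => (hcd ν hνm k x).sub (hcd μ hμ k x)) hM hconv hnot (C := 2) zero_le_two
    (fun k x => by
      refine (norm_sub_le _ _).trans ?_
      have h1 := norm_iteratedDeriv_charFun_le hνm k x
      have h2 := norm_iteratedDeriv_charFun_le hμ k x
      rw [heq] at h1
      simp only [hMdef]
      linarith)
    (fun k => by
      have := heq k
      simp only [momentSeq] at this
      rw [iteratedDeriv_charFun_zero (hνm.memLp_id k), iteratedDeriv_charFun_zero (hμ.memLp_id k),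
        this, sub_self]) t
  simpa [sub_eq_zero] using this

/-! ### From the line to the half-line. -/

/-- If a symmetric law is determinate on the line, then the law of the square is determinate on
the half-line. -/
theorem MomentDeterminate.map_sq {μ : Measure ℝ} [IsProbabilityMeasure μ]
    (hμ : MomentDeterminate μ) (hodd : ∀ k, Odd k → momentSeq μ k = 0) :
    MomentDeterminateOnNonneg (μ.map fun x => x ^ 2) := by
  have hsq : Measurable fun x : ℝ => x ^ 2 := by fun_prop
  have hmom : ∀ k, momentSeq (μ.map fun x => x ^ 2) k = momentSeq μ (2 * k) := fun k => by
    rw [momentSeq, integral_map hsq.aemeasurable (by fun_prop)]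
    simp only [← pow_mul, momentSeq]
  refine ⟨?_, fun k => ?_, fun ν hν hν0 hνm heq => ?_⟩
  · rw [Measure.map_apply hsq measurableSet_Iio]
    convert measure_empty (μ := μ)
    ext x; simp [sq_nonneg]
  · rw [integrable_map_measure (by fun_prop) hsq.aemeasurable]
    simpa only [Function.comp_def, ← pow_mul] using hμ.1 (2 * k)
  have hae : ∀ᵐ x ∂ν, 0 ≤ x := by
    rw [ae_iff]
    simpa [Iio] using hν0
  have hs : Measurable Real.sqrt := Real.continuous_sqrt.measurable
  have hs' : Measurable fun x => -Real.sqrt x := hs.neg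
  have hint : ∀ k : ℕ, Integrable (fun x : ℝ => √x ^ k) ν := fun k => by
    refine ((integrable_const (1 : ℝ)).add (hνm k)).mono' (hs.pow_const k).aestronglyMeasurable ?_
    filter_upwards [hae] with x hx
    rw [Real.norm_of_nonneg (by positivity), Pi.add_apply]
    have : x ^ k = (√x ^ k) ^ 2 := by rw [← pow_mul, mul_comm, pow_mul, Real.sq_sqrt hx]
    rw [this]
    nlinarith [sq_nonneg (√x ^ k - 1), sq_nonneg (√x ^ k)]
  have hint' : ∀ k : ℕ, Integrable (fun x : ℝ => (-√x) ^ k) ν := fun k => by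
    simp only [neg_pow (√_) k]
    exact (hint k).const_mul _
  -- The law of the square root with a fair random sign: its odd moments vanish, its even ones are
  -- the moments of `ν`, and squaring recovers `ν`.
  set ρ : Measure ℝ := (2 : ENNReal)⁻¹ • (ν.map Real.sqrt + ν.map fun x => -Real.sqrt x) with hρ
  have i1 : ∀ k : ℕ, Integrable (fun x : ℝ => x ^ k) (ν.map Real.sqrt) := fun k =>
    (integrable_map_measure (by fun_prop) hs.aemeasurable).2 (hint k)
  have i2 : ∀ k : ℕ, Integrable (fun x : ℝ => x ^ k) (ν.map fun x => -Real.sqrt x) := fun k =>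
    (integrable_map_measure (by fun_prop) hs'.aemeasurable).2 (hint' k)
  have hρprob : IsProbabilityMeasure ρ := by
    refine ⟨?_⟩
    rw [hρ, Measure.smul_apply, Measure.add_apply, Measure.map_apply hs .univ,
      Measure.map_apply hs' .univ]
    simp only [preimage_univ, measure_univ, smul_eq_mul, one_add_one_eq_two]
    exact ENNReal.inv_mul_cancel two_ne_zero ENNReal.ofNat_ne_top
  have hρμ : ρ = μ := by
    refine hμ.2 ρ hρprob (fun k => ((i1 k).add_measure (i2 k)).smul_measure (by simp)) fun k => ?_
    have hval : momentSeq ρ k = 2⁻¹ * (∫ x, √x ^ k ∂ν + ∫ x, (-√x) ^ k ∂ν) := by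
      rw [momentSeq, hρ, integral_smul_measure, integral_add_measure (i1 k) (i2 k),
        integral_map hs.aemeasurable (by fun_prop), integral_map hs'.aemeasurable (by fun_prop)]
      simp
    rcases Nat.even_or_odd k with hk | hk
    · simp only [hval, hk.neg_pow]
      obtain ⟨l, rfl⟩ := hk.exists_two_nsmul
      rw [smul_eq_mul, ← hmom, ← heq, momentSeq]
      have : ∫ x, √x ^ (2 * l) ∂ν = ∫ x, x ^ l ∂ν := integral_congr_ae <| by
        filter_upwards [hae] with x hx
        rw [pow_mul, Real.sq_sqrt hx]
      rw [this]; ring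
    · rw [hval, hodd k hk]
      simp only [hk.neg_pow, integral_neg]
      ring
  have hm1 : (ν.map Real.sqrt).map (fun x => x ^ 2) = ν := by
    rw [Measure.map_map hsq hs]
    conv_rhs => rw [← Measure.map_id (μ := ν)]
    refine Measure.map_congr ?_
    filter_upwards [hae] with x hx
    simp [Real.sq_sqrt hx]
  have hm2 : (ν.map fun x => -Real.sqrt x).map (fun x => x ^ 2) = ν := by
    rw [Measure.map_map hsq hs']
    conv_rhs => rw [← Measure.map_id (μ := ν)]
    refine Measure.map_congr ?_
    filter_upwards [hae] with x hx
    simp [Real.sq_sqrt hx]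
  rw [← hρμ, hρ, Measure.map_smul, Measure.map_add _ _ hsq, hm1, hm2, ← two_smul ENNReal ν,
    smul_smul, ENNReal.inv_mul_cancel two_ne_zero ENNReal.ofNat_ne_top, one_smul]

/-! ### The counting argument. -/

lemma tsum_ite_inv_sq_le (J : ℕ) (hJ : 1 ≤ J) :
    ∑' j : ℕ, (if J ≤ j then ENNReal.ofReal (1 / (j : ℝ) ^ 2) else 0) ≤
      2 * ENNReal.ofReal (1 / J) := by
  refine ENNReal.tsum_le_of_sum_range_le fun N => ?_
  obtain ⟨K, rfl⟩ : ∃ K, J = K + 1 := ⟨J - 1, by omega⟩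
  have h := sum_Ioo_inv_sq_le (α := ℝ) K N
  rw [← Finset.sum_filter, ← ENNReal.ofReal_sum_of_nonneg fun i _ => by positivity,
    ← ENNReal.ofReal_ofNat 2, ← ENNReal.ofReal_mul zero_le_two]
  refine ENNReal.ofReal_le_ofReal ?_
  have hset : (Finset.range N).filter (fun i => K + 1 ≤ i) = Finset.Ioo K N := by
    ext i; simp; omega
  have hr : 2 * (1 / ((K + 1 : ℕ) : ℝ)) = 2 / (K + 1) := by push_cast; ring
  rw [hset, hr]
  simpa only [one_div] using h

/-- A discrete layer-cake bound: the thresholds are 2 apart and start at 4. For small or negative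
`h` the natural floor is 0 and the summand 4 suffices. -/
lemma ofReal_le_tsum_count (h : ℝ) :
    ENNReal.ofReal h ≤ 2 * ∑' k : ℕ, (if 2 * (k : ℝ) + 4 ≤ h then 1 else 0) + 4 := by
  set n := ⌊(h - 2) / 2⌋₊ with hn
  have h1 : (n : ℝ≥0∞) ≤ ∑' k : ℕ, (if 2 * (k : ℝ) + 4 ≤ h then 1 else 0) := by
    refine le_trans (le_of_eq ?_) (ENNReal.sum_le_tsum (Finset.range n))
    rw [Finset.sum_congr rfl (g := fun _ => (1 : ℝ≥0∞))]
    · simp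
    · intro k hk
      have hk' : ((k + 1 : ℕ) : ℝ) ≤ (h - 2) / 2 :=
        (Nat.le_floor_iff' (Nat.succ_ne_zero k)).1 (Finset.mem_range.1 hk)
      push_cast at hk'
      rw [if_pos (by linarith)]
  have h2 : h ≤ 2 * n + 4 := by
    have := Nat.lt_floor_add_one ((h - 2) / 2)
    rw [← hn] at this
    linarith
  calc ENNReal.ofReal h ≤ ENNReal.ofReal (2 * n + 4) := ENNReal.ofReal_le_ofReal h2
    _ = 2 * n + 4 := by
      rw [ENNReal.ofReal_add (by positivity) (by norm_num), ENNReal.ofReal_mul zero_le_two]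
      simp
    _ ≤ _ := by gcongr

/-- The counting argument: if `h` is monotone on `[j₀, ∞)`, tends to infinity and
`∑ h j / j ^ 2 = ∞`, then a sequence `T` with `T k ≳ 1 / j` whenever `2 * k + 4 ≤ h j` has an
infinite sum. -/
lemma tsum_eq_top_of_tsum_div_sq {h : ℕ → ℝ} {j₀ : ℕ} (hj₀ : 1 ≤ j₀)
    (hlim : Tendsto h atTop atTop)
    (hdiv : ∑' j : ℕ, (if j₀ ≤ j then ENNReal.ofReal (h j / (j : ℝ) ^ 2) else 0) = ⊤)
    {T : ℕ → ℝ≥0∞} {A : ℝ≥0∞} (hA : A ≠ ⊤)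
    (hT : ∀ k j : ℕ, j₀ ≤ j → 2 * (k : ℝ) + 4 ≤ h j → ENNReal.ofReal (1 / j) ≤ A * T k) :
    ∑' k, T k = ⊤ := by
  by_contra hne
  let w : ℕ → ℝ≥0∞ := fun j => if j₀ ≤ j then ENNReal.ofReal (1 / (j : ℝ) ^ 2) else 0
  have hw : ∑' j, w j ≠ ⊤ := ne_top_of_le_ne_top
    (ENNReal.mul_ne_top ENNReal.ofNat_ne_top ENNReal.ofReal_ne_top) (tsum_ite_inv_sq_le j₀ hj₀)
  -- The indices counted lie beyond the first admissible `J`, and the tail of ∑ 1/j² from `J` is at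
  -- most 2/J.
  have hcount : ∀ k : ℕ, ∑' j, (if 2 * (k : ℝ) + 4 ≤ h j then 1 else 0) * w j
      ≤ 2 * (A * T k) := by
    intro k
    classical
    have hex : ∃ j, j₀ ≤ j ∧ 2 * (k : ℝ) + 4 ≤ h j :=
      ((eventually_ge_atTop j₀).and (hlim.eventually_ge_atTop _)).exists
    obtain ⟨hJ1, hJ2⟩ := Nat.find_spec hex
    refine le_trans (ENNReal.tsum_le_tsum fun j => ?_)
      ((tsum_ite_inv_sq_le _ (hj₀.trans hJ1)).trans
        (mul_le_mul_right (hT k _ hJ1 hJ2) 2))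
    by_cases h1 : 2 * (k : ℝ) + 4 ≤ h j
    · by_cases h2 : j₀ ≤ j
      · simp [w, h1, h2, Nat.find_min' hex ⟨h2, h1⟩]
      · simp [w, h2]
    · simp [h1]
  have hle : ∑' j : ℕ, (if j₀ ≤ j then ENNReal.ofReal (h j / (j : ℝ) ^ 2) else 0) ≤
      2 * (2 * (A * ∑' k, T k)) + 4 * ∑' j, w j := by
    calc _ ≤ ∑' j : ℕ, (2 * ∑' k : ℕ, (if 2 * (k : ℝ) + 4 ≤ h j then 1 else 0) + 4) * w j := by
          refine ENNReal.tsum_le_tsum fun j => ?_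
          by_cases h2 : j₀ ≤ j
          · simp only [w, if_pos h2]
            rw [div_eq_mul_one_div, ENNReal.ofReal_mul' (by positivity)]
            gcongr
            exact ofReal_le_tsum_count (h j)
          · simp [h2]
      _ = 2 * ∑' k : ℕ, ∑' j, (if 2 * (k : ℝ) + 4 ≤ h j then 1 else 0) * w j +
          4 * ∑' j, w j := by
          simp only [add_mul, ENNReal.tsum_add, mul_assoc, ENNReal.tsum_mul_left,
            ← ENNReal.tsum_mul_right]
          rw [ENNReal.tsum_comm]
      _ ≤ _ := by
          gcongr
          rw [← ENNReal.tsum_mul_left, ← ENNReal.tsum_mul_left]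
          exact ENNReal.tsum_le_tsum hcount
  rw [hdiv, top_le_iff] at hle
  exact ENNReal.add_ne_top.2 ⟨ENNReal.mul_ne_top ENNReal.ofNat_ne_top
    (ENNReal.mul_ne_top ENNReal.ofNat_ne_top (ENNReal.mul_ne_top hA hne)),
    ENNReal.mul_ne_top ENNReal.ofNat_ne_top hw⟩ hle

/-! ### Moments of integer-valued variables and the main theorem. -/

lemma tsum_int_natAbs_le (G : ℕ → ℝ≥0∞) : ∑' j : ℤ, G j.natAbs ≤ 2 * ∑' n, G n := by
  have hsurj : Function.Surjective (Sum.elim (fun n : ℕ => (n : ℤ)) fun n : ℕ => -(n : ℤ)) := by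
    intro j
    rcases Int.natAbs_eq j with h | h
    · exact ⟨Sum.inl j.natAbs, h.symm⟩
    · exact ⟨Sum.inr j.natAbs, h.symm⟩
  refine (ENNReal.tsum_le_tsum_comp_of_surjective hsurj _).trans (le_of_eq ?_)
  rw [ENNReal.summable.tsum_sum ENNReal.summable]
  simp [two_mul]

/-- Moments of an integer-valued random variable whose tail beyond `j` is dominated by
`|i| ^ (-(2 * K + 2))`. -/
lemma lintegral_pow_le {Ω : Type*} [MeasurableSpace Ω] (P : Measure Ω) [IsProbabilityMeasure P]
    {X : Ω → ℤ} (hX : Measurable X) {p : ℤ → ℝ} (hp : ∀ j, p j = P.real (X ⁻¹' {j}))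
    (K j : ℕ) (htail : ∀ i : ℤ, j ≤ i.natAbs → (i.natAbs : ℝ) ^ (2 * K) * p i ≤
      1 / (i.natAbs : ℝ) ^ 2) :
    ∫⁻ ω, ENNReal.ofReal ((X ω : ℝ) ^ (2 * K)) ∂P ≤
      ENNReal.ofReal ((j : ℝ) ^ (2 * K)) + 2 * ∑' n : ℕ, ENNReal.ofReal (1 / (n : ℝ) ^ 2) := by
  have hmap : ∫⁻ ω, ENNReal.ofReal ((X ω : ℝ) ^ (2 * K)) ∂P =
      ∑' i : ℤ, ENNReal.ofReal ((i : ℝ) ^ (2 * K)) * P.map X {i} := by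
    rw [← lintegral_countable', lintegral_map (Measurable.of_discrete) hX]
  have hprob : IsProbabilityMeasure (P.map X) := Measure.isProbabilityMeasure_map hX.aemeasurable
  have hone : ∑' i : ℤ, P.map X {i} = 1 := by
    have := lintegral_countable' (μ := P.map X) (fun _ : ℤ => (1 : ℝ≥0∞))
    simpa using this.symm
  have hpi : ∀ i, P.map X {i} = ENNReal.ofReal (p i) := fun i => by
    rw [Measure.map_apply hX (measurableSet_singleton i), hp, ofReal_measureReal]
  rw [hmap]
  calc _ ≤ ∑' i : ℤ, (ENNReal.ofReal ((j : ℝ) ^ (2 * K)) * P.map X {i} +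
        ENNReal.ofReal (1 / (i.natAbs : ℝ) ^ 2)) := by
        refine ENNReal.tsum_le_tsum fun i => ?_
        have hi : (i : ℝ) ^ (2 * K) = (i.natAbs : ℝ) ^ (2 * K) := by
          rw [pow_mul, pow_mul, Nat.cast_natAbs, Int.cast_abs, sq_abs]
        rw [hi]
        rcases le_or_gt j i.natAbs with h | h
        · refine le_add_left ?_
          rw [hpi, ← ENNReal.ofReal_mul (by positivity)]
          exact ENNReal.ofReal_le_ofReal (htail i h)
        · refine le_add_right ?_
          gcongr
    _ ≤ _ := by
        rw [ENNReal.tsum_add, ENNReal.tsum_mul_left, hone, mul_one]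
        gcongr
        exact tsum_int_natAbs_le fun n => ENNReal.ofReal (1 / (n : ℝ) ^ 2)

theorem theorem3 {Ω : Type*} [MeasurableSpace Ω] (P : Measure Ω) [IsProbabilityMeasure P]
    (X : Ω → ℤ) (hX : Measurable X)
    (p : ℤ → ℝ) (hp : ∀ j : ℤ, p j = P.real (X ⁻¹' {j}))
    (hpos : ∀ j : ℤ, 0 < p j)
    (hsymm : IdentDistrib X (fun ω => -X ω) P P)
    (hmom : ∀ k : ℕ, Integrable (fun ω => (X ω : ℝ) ^ k) P)
    (j₀ : ℕ) (hj₀ : 2 ≤ j₀)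
    (hsum : ∑' j : {j : ℤ // (j₀ : ℤ) ≤ |j|},
      ENNReal.ofReal (-Real.log (p j) / (((j : ℤ) : ℝ) ^ 2 * Real.log |((j : ℤ) : ℝ)|)) = ⊤)
    (hmono : MonotoneOn (fun j : ℕ => -Real.log (p j) / Real.log (j : ℝ)) (Ici j₀))
    (hlim : Tendsto (fun j : ℕ => -Real.log (p j) / Real.log (j : ℝ)) atTop atTop) :
    CarlemanHamburger (P.map (fun ω => (X ω : ℝ))) ∧
    MomentDeterminate (P.map (fun ω => (X ω : ℝ))) ∧
    MomentDeterminateOnNonneg (P.map (fun ω => (X ω : ℝ) ^ 2)) := by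
  have hXr : Measurable fun ω => (X ω : ℝ) := (Measurable.of_discrete (f := Int.cast)).comp hX
  set μ : Measure ℝ := P.map fun ω => (X ω : ℝ) with hμ
  have hprob : IsProbabilityMeasure μ := Measure.isProbabilityMeasure_map hXr.aemeasurable
  have hfin : HasFiniteMoments μ := fun k =>
    (integrable_map_measure (by fun_prop) hXr.aemeasurable).2 (hmom k)
  have hms : ∀ k, momentSeq μ k = ∫ ω, (X ω : ℝ) ^ k ∂P := fun k =>
    integral_map hXr.aemeasurable (by fun_prop)
  have hodd : ∀ k, Odd k → momentSeq μ k = 0 := by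
    intro k hk
    have h := (hsymm.comp (u := fun i : ℤ => (i : ℝ) ^ k) Measurable.of_discrete).integral_eq
    simp only [Function.comp_def, Int.cast_neg, hk.neg_pow, integral_neg] at h
    rw [hms]
    linarith
  have hpneg : ∀ j, p (-j) = p j := by
    intro j
    have h := hsymm.measure_mem_eq (measurableSet_singleton j)
    rw [hp, hp, measureReal_def, measureReal_def, h]
    congr 2
    ext ω
    simp [eq_neg_iff_add_eq_zero, neg_eq_iff_add_eq_zero]
  have hpabs : ∀ j : ℤ, p j = p j.natAbs := by
    intro j
    rcases Int.natAbs_eq j with h | h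
    · exact congrArg p h
    · exact (congrArg p h).trans (hpneg _)
  set h : ℕ → ℝ := fun j => -Real.log (p j) / Real.log (j : ℝ) with hh
  have hevenpos : ∀ k, 0 < momentSeq μ (2 * k) := by
    intro k
    have hk1 : 0 < P.real (X ⁻¹' {1}) := hp 1 ▸ hpos 1
    rw [hms]
    refine hk1.trans_le ?_
    rw [← integral_indicator_one (hX (measurableSet_singleton 1))]
    refine integral_mono ((integrable_const (1 : ℝ)).indicator (hX (measurableSet_singleton 1)))
      (hmom _) fun ω => ?_
    by_cases hω : X ω = 1
    · simp [indicator, hω]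
    · simp only [indicator, mem_preimage, mem_singleton_iff, hω, if_false]
      rw [pow_mul]; positivity
  have hdiv : ∑' j : ℕ, (if j₀ ≤ j then ENNReal.ofReal (h j / (j : ℝ) ^ 2) else 0) = ⊤ := by
    set G : ℕ → ℝ≥0∞ := fun j => if j₀ ≤ j then ENNReal.ofReal (h j / (j : ℝ) ^ 2) else 0
      with hG
    have hle : (⊤ : ℝ≥0∞) ≤ 2 * ∑' n, G n := by
      rw [← hsum]
      refine le_trans (le_of_eq ?_) ((ENNReal.tsum_comp_le_tsum_of_injective
        (Subtype.val_injective (p := fun j : ℤ => (j₀ : ℤ) ≤ |j|))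
        fun j : ℤ => G j.natAbs).trans (tsum_int_natAbs_le G))
      refine tsum_congr fun j => ?_
      have hj : j₀ ≤ (j : ℤ).natAbs := by
        have := j.2
        rw [Int.abs_eq_natAbs] at this
        exact_mod_cast this
      simp only [hG, if_pos hj, hh]
      have hc : (((j : ℤ).natAbs : ℕ) : ℝ) = |((j : ℤ) : ℝ)| := by
        rw [Nat.cast_natAbs, Int.cast_abs]
      rw [hpabs, hc, sq_abs, div_div, mul_comm (Real.log |_|)]
    by_contra hne
    exact ENNReal.mul_ne_top ENNReal.ofNat_ne_top hne (top_le_iff.1 hle)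
  set S : ℝ≥0∞ := 2 * ∑' n : ℕ, ENNReal.ofReal (1 / (n : ℝ) ^ 2) with hS
  have hSfin : S ≠ ⊤ := ENNReal.mul_ne_top ENNReal.ofNat_ne_top
    (Real.summable_one_div_nat_pow.2 one_lt_two).tsum_ofReal_ne_top
  -- The threshold `2 * k + 4` exceeds the moment order by 2, which leaves the summable factor 1/i².
  have htail : ∀ k j : ℕ, j₀ ≤ j → 2 * (k : ℝ) + 4 ≤ h j → ∀ i : ℤ, j ≤ i.natAbs →
      (i.natAbs : ℝ) ^ (2 * (k + 1)) * p i ≤ 1 / (i.natAbs : ℝ) ^ 2 := by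
    intro k j hj hkj i hi
    set n := i.natAbs
    have hn : (1 : ℝ) < n := by exact_mod_cast (by omega : 1 < n)
    have hlog := Real.log_pos hn
    have hhn : 2 * (k : ℝ) + 4 ≤ h n := hkj.trans (hmono hj (hj.trans hi) hi)
    rw [hh, le_div_iff₀ hlog] at hhn
    rw [hpabs i, le_div_iff₀ (by positivity)]
    have hle : p n ≤ ((n : ℝ) ^ (2 * k + 4))⁻¹ := by
      rw [← Real.log_le_log_iff (hpos _) (by positivity), Real.log_inv, Real.log_pow]
      push_cast
      linarith
    calc _ ≤ (n : ℝ) ^ (2 * (k + 1)) * ((n : ℝ) ^ (2 * k + 4))⁻¹ * (n : ℝ) ^ 2 := by gcongr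
      _ = 1 := by
        rw [show 2 * k + 4 = 2 * (k + 1) + 2 by ring, pow_add (n : ℝ) (2 * (k + 1)) 2]
        field_simp
  have hcarl : CarlemanHamburger μ := by
    refine ⟨hfin, ?_⟩
    refine tsum_eq_top_of_tsum_div_sq (by omega) hlim hdiv
      (A := ENNReal.ofReal (1 + S.toReal)) ENNReal.ofReal_ne_top fun k j hj hkj => ?_
    have hjpos : (1 : ℝ) ≤ j := by exact_mod_cast (by omega : 1 ≤ j)
    have hS0 : 0 ≤ S.toReal := ENNReal.toReal_nonneg
    -- As j ≥ 1, the additive constant S is absorbed into the base, so the root costs only the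
    -- factor 1 + S, uniformly in `k`.
    have hm : momentSeq μ (2 * (k + 1)) ≤ ((1 + S.toReal) * j) ^ (2 * (k + 1)) := by
      have h1 := lintegral_pow_le P hX hp (k + 1) j (htail k j hj hkj)
      rw [← ofReal_integral_eq_lintegral_ofReal (hmom _)
        (ae_of_all _ fun ω => by simp only [pow_mul, Pi.zero_apply]; positivity), ← hms, ← hS,
        ← ENNReal.ofReal_toReal hSfin, ← ENNReal.ofReal_add (by positivity) hS0] at h1
      have h2 := (ENNReal.ofReal_le_ofReal_iff (by positivity)).1 h1
      have h3 : (1 : ℝ) ≤ (j : ℝ) ^ (2 * (k + 1)) := one_le_pow₀ hjpos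
      have h4 : 1 + S.toReal ≤ (1 + S.toReal) ^ (2 * (k + 1)) :=
        le_self_pow₀ (by linarith) (by omega)
      rw [mul_pow]
      nlinarith
    have hAj : 0 < (1 + S.toReal) * j := by positivity
    rw [ENNReal.ofReal_rpow_of_pos (hevenpos _), ← ENNReal.ofReal_mul (by positivity)]
    refine ENNReal.ofReal_le_ofReal ?_
    have hk : (0 : ℝ) < 2 * (k + 1) := by positivity
    have hroot : ((1 + S.toReal) * j)⁻¹ ≤
        momentSeq μ (2 * (k + 1)) ^ (-(1 / (2 * ((k : ℝ) + 1)))) := by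
      rw [Real.rpow_neg (hevenpos _).le, one_div]
      refine inv_anti₀ (Real.rpow_pos_of_pos (hevenpos _) _) ?_
      rw [Real.rpow_inv_le_iff_of_pos (hevenpos _).le hAj.le hk]
      refine hm.trans_eq ?_
      rw [← Real.rpow_natCast]
      push_cast
      rfl
    calc (1 : ℝ) / j = (1 + S.toReal) * ((1 + S.toReal) * j)⁻¹ := by
          field_simp
      _ ≤ _ := by gcongr
  have hdet := hcarl.momentDeterminate hevenpos
  refine ⟨hcarl, hdet, ?_⟩
  have hsq := hdet.map_sq hodd
  rwa [hμ, Measure.map_map (by fun_prop) hXr] at hsq
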